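/- Let $\ell\ge 1$ and let $\xi_1,\dots,\xi_\ell\in L^2(\mathbb{R};\mathbb{C})$ be pulse functions, none of which vanishes almost everywhere. Let $b(t)$, $b^*(t)$ be the annihilation and creation operators of a single-channel free boson field, acting on the symmetric Fock space over $L^2(\mathbb{R})$, i.e. $(b(t)\Psi)_n(s_1,\dots,s_n)=\sqrt{n+1}\,\Psi_{n+1}(t,s_1,\dots,s_n)$, let $|0\rangle$ be the vacuum, and put $B^*(\xi)=\int b^*(t)\xi(t)\,dt$, $B(\xi)=\int b(t)\xi(t)^*\,dt$. Define $$N_\ell=\sum_{P\in S_\ell}\int_{\mathbb{R}^\ell}\prod_{k=1}^\ell \xi_k(t_k)^*\prod_{k=1}^\ell\xi_k(t_{P(k)})\,dt_1\cdots dt_\ell,\qquad |\psi_\ell\rangle=\frac1{\sqrt{N_\ell}}\prod_{k=1}^\ell B^*(\xi_k)|0\rangle,$$ $$\mathcal{C}^{ik}=\Big\langle 0\Big|\prod_{\alpha\ne i}B(\xi_\alpha)\prod_{\beta\ne k}B^*(\xi_\beta)\Big|0\Big\rangle\qquad(\mathcal{C}^{11}=1\text{ if }\ell=1).$$ Let $\breve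 b(t)=[\,b(t)\ \ b^*(t)\,]^T$ and $\breve b^\dag(r)=[\,b^*(r)\ \ b(r)\,]$, and for $u,v\in\mathbb{C}$ let $\Delta(u,v)=\begin{bmatrix}u&v\\ v^*&u^*\end{bmatrix}$. Then the field covariance $R(t,r)=\langle\psi_\ell|\breve b(t)\breve b^\dag(r)|\psi_\ell\rangle$ is $$R(t,r)=\delta(t-r)\begin{bmatrix}1&0\\0&0\end{bmatrix}+\frac1{N_\ell}\sum_{i=1}^\ell\sum_{k=1}^\ell\Delta\big(\mathcal{C}^{ik}\xi_k(t)\xi_i(r)^*,0\big)$$ as an identity between $2\times2$ matrices of distributions; that is, for all $f,g\in L^2(\mathbb{R};\mathbb{C})$ (in particular for all test functions) both sides agree when smeared with $f(t)g(r)$, the left side being smeared by means of $\int b(t)f(t)\,dt$, $\int b^*(t)f(t)\,dt$, and likewise with $g$, and $\delta(t-r)$ being evaluated to $\int f(t)g(t)\,dt$. Moreover, for every $t\in\mathbb{R}$, the field intensity $\bar n(t)=\langle\psi_\ell|b^*(t)b(t)|\psi_\ell\rangle=\|b(t)\psi_\ell\|^2$ is $$\bar n(t)=\frac1{N_\ell}\sum_{i=1}^\ell\sum_{k=1}^\ell\mathcal{C}^{ik}\,\xi_i(t)^*\xi_k(t).$$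 -/

import Mathlib

open MeasureTheory

noncomputable section

namespace PhotonField

/-- A vector of the single-channel symmetric (boson) Fock space over `L²(ℝ)`, given by its sequence
of wave functions: the `n`-photon component is a function of the `n` times `s 0, …, s (n - 1)`.
Vectors of the Fock space are symmetric and square integrable in each component and are identified
when they agree almost everywhere.  Genuine functions are used, since the field operator `b t`
evaluates wave functions at a point. -/
abbrev FockVector : Type := (n : ℕ) → (Fin n → ℝ) → ℂ

/-- The inner product `⟨Φ|Ψ⟩`, conjugate linear in the first argument. -/
def braket (Φ Ψ : FockVector) : ℂ :=
  ∑' n : ℕ, ∫ s : Fin n → ℝ, star (Φ n s) * Ψ n s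

/-- The vacuum `|0⟩`. -/
def vacuum : FockVector := fun n _ => if n = 0 then 1 else 0

/-- The annihilation operator `b(t)` at time `t`:
`(b(t) Ψ)_n (s₁, …, s_n) = √(n + 1) Ψ_{n+1} (t, s₁, …, s_n)`. -/
def b (t : ℝ) (Ψ : FockVector) : FockVector :=
  fun n s => (Real.sqrt ((n : ℝ) + 1) : ℂ) * Ψ (n + 1) (Fin.cons t s)

/-- The smeared annihilation operator `∫ b(t) f(t) dt` (no conjugate on `f`). -/
def smearedB (f : ℝ → ℂ) (Ψ : FockVector) : FockVector :=
  fun n s => ∫ t : ℝ, f t * b t Ψ n s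

/-- The smeared creation operator `∫ b*(t) f(t) dt`, that is `B*(f)`:
`(B*(f) Ψ)_{n+1} (s₁, …, s_{n+1}) = (n + 1)^{-1/2} ∑_j f(s_j) Ψ_n (s₁, …, s_j omitted, …, s_{n+1})`,
with vanishing zero-photon component.  (The operator `b*(t)` itself is not an operator on Fock space:
it would insert a Dirac function at `t`; it makes sense as a quadratic form,
`⟨Φ|b*(t)|Ψ⟩ = ⟨b(t)Φ|Ψ⟩`, or smeared as here.) -/
def creation (f : ℝ → ℂ) (Ψ : FockVector) : FockVector
  | 0, _ => 0
  | n + 1, s =>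
      ((Real.sqrt ((n : ℝ) + 1) : ℂ))⁻¹ *
        ∑ j : Fin (n + 1), f (s j) * Ψ n (fun i => s (j.succAbove i))

/-- `B(f) = ∫ b(t) f(t)^* dt`, the adjoint of `B*(f)`. -/
def annihilation (f : ℝ → ℂ) : FockVector → FockVector :=
  smearedB (fun t => star (f t))

/-- The product `∏_k B*(ξ_k)` over the indices in the list, applied to `Ψ`. -/
def creationProd {ℓ : ℕ} (ξ : Fin ℓ → ℝ → ℂ) (L : List (Fin ℓ)) (Ψ : FockVector) : FockVector :=
  L.foldr (fun k Φ => creation (ξ k) Φ) Ψ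

/-- The product `∏_k B(ξ_k)` over the indices in the list, applied to `Ψ`. -/
def annihilationProd {ℓ : ℕ} (ξ : Fin ℓ → ℝ → ℂ) (L : List (Fin ℓ)) (Ψ : FockVector) :
    FockVector :=
  L.foldr (fun k Φ => annihilation (ξ k) Φ) Ψ

/-- The normalization coefficient
`N_ℓ = ∑_P ∫ ξ_ℓ(t_ℓ)^* ⋯ ξ_1(t_1)^* ξ_1(P(t_1)) ⋯ ξ_ℓ(P(t_ℓ)) dt_1 ⋯ dt_ℓ`. -/
def normalization {ℓ : ℕ} (ξ : Fin ℓ → ℝ → ℂ) : ℂ :=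
  ∑ P : Equiv.Perm (Fin ℓ), ∫ t : Fin ℓ → ℝ,
    (∏ k, star (ξ k (t k))) * ∏ k, ξ k (t (P k))

/-- The factorizable `ℓ`-photon state `|ψ_ℓ⟩ = N_ℓ^{-1/2} ∏_k B*(ξ_k) |0⟩`
(the number `N_ℓ` is real, so that it agrees with its real part). -/
def photonState {ℓ : ℕ} (ξ : Fin ℓ → ℝ → ℂ) : FockVector :=
  ((Real.sqrt (normalization ξ).re : ℂ))⁻¹ • creationProd ξ (List.finRange ℓ) vacuum

/-- The matrix entries `C^{ik} = ⟨0| ∏_{α ≠ i} B(ξ_α) ∏_{β ≠ k} B*(ξ_β) |0⟩`; for `ℓ = 1` the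
products are empty and the only entry is `⟨0|0⟩`. -/
def photonC {ℓ : ℕ} (ξ : Fin ℓ → ℝ → ℂ) (i k : Fin ℓ) : ℂ :=
  braket vacuum
    (annihilationProd ξ ((List.finRange ℓ).filter (fun α => α ≠ i))
      (creationProd ξ ((List.finRange ℓ).filter (fun β => β ≠ k)) vacuum))

/-- The field intensity `⟨Ψ|b*(t)b(t)|Ψ⟩`, that is `⟨b(t)Ψ|b(t)Ψ⟩`. -/
def intensity (Ψ : FockVector) (t : ℝ) : ℂ := braket (b t Ψ) (b t Ψ)

/-- The smeared entries `∫ b̆_j(t) f(t) dt` of the doubled-up column `b̆ = [b, b*]ᵀ`. -/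
def doubledUp (f : ℝ → ℂ) : Fin 2 → FockVector → FockVector := ![smearedB f, creation f]

/-- The smeared entries `∫ b̆†_k(r) g(r) dr` of the row `b̆† = [b*, b]`. -/
def doubledUpDag (g : ℝ → ℂ) : Fin 2 → FockVector → FockVector := ![creation g, smearedB g]

/-- The field covariance `R(t, r) = ⟨Ψ|b̆(t) b̆†(r)|Ψ⟩`, a 2-by-2 matrix of distributions in `(t, r)`,
evaluated on `f(t) g(r)`: its value is `∬ R(t, r) f(t) g(r) dt dr`. -/
def covariance (Ψ : FockVector) (f g : ℝ → ℂ) : Matrix (Fin 2) (Fin 2) ℂ :=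
  Matrix.of fun j k => braket Ψ (doubledUp f j (doubledUpDag g k Ψ))

/-- The distribution `δ(t - r)`, evaluated on `f(t) g(r)`. -/
def deltaPairing (f g : ℝ → ℂ) : ℂ := ∫ t : ℝ, f t * g t

/-- The distribution given by a matrix-valued function `K(t, r)`, evaluated on `f(t) g(r)`. -/
def kernelPairing (K : ℝ → ℝ → Matrix (Fin 2) (Fin 2) ℂ) (f g : ℝ → ℂ) :
    Matrix (Fin 2) (Fin 2) ℂ :=
  Matrix.of fun j k => ∫ p : ℝ × ℝ, K p.1 p.2 j k * (f p.1 * g p.2)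

/-- `Δ(u, v) = [u v; v^# u^#]` for 1-by-1 blocks. -/
def Δ (u v : ℂ) : Matrix (Fin 2) (Fin 2) ℂ := !![u, v; star v, star u]

end PhotonField

end

namespace PhotonField

/-! ### Pointwise identities -/

/-! The proof rests on the commutation relation `b t B*(f) = f(t) + B*(f) b t` (`b_creation`). Since
`b t` kills the vacuum, it acts on a product of creation operators as a derivation: it yields the
sum over `k` of `ξ k t` times the product with factor `k` deleted (`b_creationProd`). By
adjointness, the inner products of these shortened vectors are the numbers `C^{ik}`
(`photonC_eq_braket`), and the intensity formula follows.

In the covariance, the `b* b` entry is the same computation smeared; the `b b*` entry differs from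
it by the commutator, which contributes the delta term; the other two entries change the photon
number by two and vanish.

The delta term has coefficient one because `N_ℓ` is the squared norm of the unnormalized product
(`normalization_eq_braket`) and is nonzero (`braket_creationProd_pos`).

Integrability and exact symmetry are secured by working with `FinitePhoton` vectors, a class closed
under all smeared operators. -/

theorem creation_zero_apply (f : ℝ → ℂ) (Ψ : FockVector) (s : Fin 0 → ℝ) :
    creation f Ψ 0 s = 0 := rfl

theorem creation_succ_apply (f : ℝ → ℂ) (Ψ : FockVector) (n : ℕ) (s : Fin (n + 1) → ℝ) :
    creation f Ψ (n + 1) s = ((Real.sqrt ((n : ℝ) + 1) : ℂ))⁻¹ *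
      ∑ j : Fin (n + 1), f (s j) * Ψ n (fun i => s (j.succAbove i)) := rfl

theorem sqrt_succ_ne_zero (n : ℕ) : (Real.sqrt ((n : ℝ) + 1) : ℂ) ≠ 0 := by
  have : (0 : ℝ) < Real.sqrt ((n : ℝ) + 1) := Real.sqrt_pos.mpr (by positivity)
  exact_mod_cast this.ne'

theorem creation_add (f : ℝ → ℂ) (Φ Ψ : FockVector) :
    creation f (Φ + Ψ) = creation f Φ + creation f Ψ := by
  funext n s
  cases n with
  | zero => simp [creation_zero_apply]
  | succ n => simp [creation_succ_apply, mul_add, Finset.sum_add_distrib]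

theorem creation_smul (f : ℝ → ℂ) (c : ℂ) (Ψ : FockVector) :
    creation f (c • Ψ) = c • creation f Ψ := by
  funext n s
  cases n with
  | zero => simp [creation_zero_apply]
  | succ n =>
    simp only [creation_succ_apply, Pi.smul_apply, smul_eq_mul, Finset.mul_sum]
    exact Finset.sum_congr rfl fun j _ => by ring

theorem b_smul (t : ℝ) (c : ℂ) (Ψ : FockVector) : b t (c • Ψ) = c • b t Ψ := by
  funext n s
  simp only [b, Pi.smul_apply, smul_eq_mul]
  ring

theorem smearedB_smul (f : ℝ → ℂ) (c : ℂ) (Ψ : FockVector) :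
    smearedB f (c • Ψ) = c • smearedB f Ψ := by
  funext n s
  simp only [smearedB, b_smul, Pi.smul_apply, smul_eq_mul, ← integral_const_mul]
  exact integral_congr_ae (.of_forall fun t => by simp only; ring)

theorem b_vacuum (t : ℝ) : b t vacuum = 0 := by
  funext n s
  simp [b, vacuum]

theorem smearedB_vacuum (f : ℝ → ℂ) : smearedB f vacuum = 0 := by
  funext n s
  simp [smearedB, b_vacuum]

/-- The canonical commutation relation between `b t` and `B*(f)`. -/
theorem b_creation (t : ℝ) (f : ℝ → ℂ) (Ψ : FockVector) :
    b t (creation f Ψ) = f t • Ψ + creation f (b t Ψ) := by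
  funext n s
  have h := sqrt_succ_ne_zero n
  simp only [b, creation_succ_apply, Pi.add_apply, Pi.smul_apply, smul_eq_mul]
  -- The summand `j = 0` evaluates `f` at the inserted time `t`; the others leave `t` inside `Ψ` and
  -- form `creation f (b t Ψ)`.
  rw [mul_inv_cancel_left₀ h, Fin.sum_univ_succ]
  congr 1
  cases n with
  | zero => simp [creation_zero_apply]
  | succ n =>
    have h := sqrt_succ_ne_zero n
    rw [creation_succ_apply, Finset.mul_sum]
    refine Finset.sum_congr rfl fun j _ => ?_
    have : (fun i => (Fin.cons t s : Fin (n + 2) → ℝ) (j.succ.succAbove i)) =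
        Fin.cons t (fun i => s (j.succAbove i)) := by
      funext i
      refine Fin.cases ?_ (fun i => ?_) i <;> simp
    simp only [this, b, Fin.cons_succ]
    field_simp

theorem creation_comm (f g : ℝ → ℂ) (Ψ : FockVector) :
    creation f (creation g Ψ) = creation g (creation f Ψ) := by
  funext n s
  match n with
  | 0 => rfl
  | 1 => simp [creation]
  | n + 2 =>
    simp only [creation_succ_apply, Finset.mul_sum]
    rw [← Fintype.sum_prod_type', ← Fintype.sum_prod_type']
    -- Both sides sum over ordered pairs of removed coordinates. This involution exchanges the order
    -- in which the two are removed.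
    refine Finset.sum_nbij' (fun p => (p.1.succAbove p.2, p.2.predAbove p.1))
      (fun p => (p.1.succAbove p.2, p.2.predAbove p.1)) (by simp) (by simp) ?_ ?_ ?_
    · rintro ⟨i, j⟩ -
      simp [Fin.succAbove_succAbove_predAbove, Fin.predAbove_predAbove_succAbove]
    · rintro ⟨i, j⟩ -
      simp [Fin.succAbove_succAbove_predAbove, Fin.predAbove_predAbove_succAbove]
    · rintro ⟨i, j⟩ -
      simp only [Fin.succAbove_succAbove_succAbove_predAbove, Fin.succAbove_succAbove_predAbove]
      ring

theorem star_braket (Φ Ψ : FockVector) : star (braket Φ Ψ) = braket Ψ Φ := by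
  rw [braket, tsum_star]
  refine tsum_congr fun n => ?_
  rw [Complex.star_def, ← integral_conj]
  refine integral_congr_ae (.of_forall fun s => ?_)
  simp [mul_comm]

theorem braket_smul_right (c : ℂ) (Φ Ψ : FockVector) : braket Φ (c • Ψ) = c * braket Φ Ψ := by
  rw [braket, braket, ← tsum_mul_left]
  refine tsum_congr fun n => ?_
  rw [← integral_const_mul]
  refine integral_congr_ae (.of_forall fun s => ?_)
  simp only [Pi.smul_apply, smul_eq_mul]
  ring

theorem braket_smul_left (c : ℂ) (Φ Ψ : FockVector) :
    braket (c • Φ) Ψ = star c * braket Φ Ψ := by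
  rw [← star_braket, braket_smul_right, star_mul', star_braket]

theorem braket_eq_zero {Φ Ψ : FockVector} (h : ∀ n, Φ n = 0 ∨ Ψ n = 0) : braket Φ Ψ = 0 := by
  rw [braket, ← tsum_zero (β := ℕ)]
  refine tsum_congr fun n => ?_
  rcases h n with h | h <;> simp [h]

theorem braket_zero_right (Φ : FockVector) : braket Φ 0 = 0 :=
  braket_eq_zero fun _ => .inr rfl

/-! ### Square integrability -/

theorem _root_.MeasureTheory.MemLp.two_mul_prod {α β : Type*} [MeasurableSpace α]
    [MeasurableSpace β] {μ : Measure α} {ν : Measure β} [SFinite μ] [SFinite ν]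
    {f : α → ℂ} {g : β → ℂ} (hf : MemLp f 2 μ) (hg : MemLp g 2 ν) :
    MemLp (fun p : α × β => f p.1 * g p.2) 2 (μ.prod ν) := by
  have hm : AEStronglyMeasurable (fun p : α × β => f p.1 * g p.2) (μ.prod ν) :=
    hf.1.comp_fst.mul hg.1.comp_snd
  rw [memLp_two_iff_integrable_sq_norm hm]
  have h := ((memLp_two_iff_integrable_sq_norm hf.1).1 hf).mul_prod
    ((memLp_two_iff_integrable_sq_norm hg.1).1 hg)
  refine h.congr (.of_forall fun p => ?_)
  simp [mul_pow]

theorem memLp_apply_mul_succAbove {n : ℕ} (j : Fin (n + 1)) {f : ℝ → ℂ}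
    {φ : (Fin n → ℝ) → ℂ} (hf : MemLp f 2) (hφ : MemLp φ 2) :
    MemLp (fun s : Fin (n + 1) → ℝ => f (s j) * φ (fun i => s (j.succAbove i))) 2 :=
  (hf.two_mul_prod hφ).comp_measurePreserving
    (volume_preserving_piFinSuccAbove (fun _ : Fin (n + 1) => ℝ) j)

theorem integrable_star_mul {α : Type*} [MeasurableSpace α] {μ : Measure α} {f g : α → ℂ}
    (hf : MemLp f 2 μ) (hg : MemLp g 2 μ) : Integrable (fun x => star (f x) * g x) μ :=
  hf.star.integrable_mul hg

theorem integrable_mul_two {α : Type*} [MeasurableSpace α] {μ : Measure α} {f g : α → ℂ}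
    (hf : MemLp f 2 μ) (hg : MemLp g 2 μ) : Integrable (fun x => f x * g x) μ :=
  hf.integrable_mul hg

/-! ### Finite-photon vectors -/

/-- The vectors obtained from the vacuum by finitely many smeared creation operators with square
integrable pulses and linear combinations. -/
inductive FinitePhoton : FockVector → Prop
  | vacuum : FinitePhoton vacuum
  | add {Φ Ψ : FockVector} : FinitePhoton Φ → FinitePhoton Ψ → FinitePhoton (Φ + Ψ)
  | smul (c : ℂ) {Ψ : FockVector} : FinitePhoton Ψ → FinitePhoton (c • Ψ)
  | creation {f : ℝ → ℂ} {Ψ : FockVector} : MemLp f 2 → FinitePhoton Ψ →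
      FinitePhoton (creation f Ψ)

namespace FinitePhoton

theorem zero : FinitePhoton 0 := by
  simpa using FinitePhoton.smul 0 .vacuum

theorem sum {ι : Type*} {S : Finset ι} {Ψ : ι → FockVector} (h : ∀ i ∈ S, FinitePhoton (Ψ i)) :
    FinitePhoton (∑ i ∈ S, Ψ i) :=
  Finset.sum_induction _ _ (fun _ _ => .add) .zero h

theorem memLp {Ψ : FockVector} (h : FinitePhoton Ψ) (n : ℕ) : MemLp (Ψ n) 2 := by
  induction h generalizing n with
  | vacuum =>
    cases n with
    | zero =>
      have : ∀ i : Fin 0, IsFiniteMeasure (volume : Measure ℝ) := fun i => i.elim0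
      have : IsFiniteMeasure (volume : Measure (Fin 0 → ℝ)) := by
        rw [volume_pi]; infer_instance
      exact memLp_const (1 : ℂ)
    | succ n => exact MemLp.zero
  | add _ _ h₁ h₂ => exact (h₁ n).add (h₂ n)
  | smul c _ h => exact (h n).const_smul c
  | creation hf _ h =>
    cases n with
    | zero => exact MemLp.zero
    | succ n =>
      exact (memLp_finsetSum _ fun j _ => memLp_apply_mul_succAbove j hf (h n)).const_mul _

/-- A permutation restricts to a bijection from the complement of `j` to the complement of `σ j`;
`succAbove` identifies each with `Fin n`. -/
theorem exists_perm_succAbove {n : ℕ} (σ : Equiv.Perm (Fin (n + 1))) (j : Fin (n + 1)) :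
    ∃ τ : Equiv.Perm (Fin n), ∀ i, σ (j.succAbove i) = (σ j).succAbove (τ i) := by
  refine ⟨((finSuccAboveEquiv j).trans (σ.subtypeEquiv fun a => by simp)).trans
    (finSuccAboveEquiv (σ j)).symm, fun i => ?_⟩
  have h := (finSuccAboveEquiv (σ j)).apply_symm_apply
    ((σ.subtypeEquiv (p := (· ≠ j)) (q := (· ≠ σ j)) fun a => by simp) (finSuccAboveEquiv j i))
  exact (congrArg Subtype.val h).symm

/-- Symmetry holds at every point, not just almost everywhere, so it can be used on slices with one
coordinate fixed. -/
theorem symm {Ψ : FockVector} (h : FinitePhoton Ψ) (n : ℕ) (σ : Equiv.Perm (Fin n))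
    (s : Fin n → ℝ) : Ψ n (fun i => s (σ i)) = Ψ n s := by
  induction h generalizing n with
  | vacuum => rfl
  | add _ _ h₁ h₂ => simp [h₁, h₂]
  | smul c _ h => simp [h]
  | creation hf _ h =>
    cases n with
    | zero => rfl
    | succ n =>
      rw [creation_succ_apply, creation_succ_apply]
      congr 1
      conv_rhs => rw [← Equiv.sum_comp σ]
      refine Finset.sum_congr rfl fun j _ => ?_
      obtain ⟨τ, hτ⟩ := exists_perm_succAbove σ j
      simp only [hτ]
      rw [h n τ fun i => s ((σ j).succAbove i)]

theorem insertNth {Ψ : FockVector} (h : FinitePhoton Ψ) (n : ℕ) (j : Fin (n + 1)) (t : ℝ)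
    (s : Fin n → ℝ) :
    Ψ (n + 1) (Fin.insertNth (α := fun _ => ℝ) j t s) =
      Ψ (n + 1) (Fin.cons (α := fun _ => ℝ) t s) := by
  rw [← Fin.cons_comp_cycleRange]
  exact h.symm _ j.cycleRange _

/-- Fubini would give this only for almost every `s`. Induction through `b_creation` gives it for
every `s`, which makes the smeared identities exact. -/
theorem memLp_b {Ψ : FockVector} (h : FinitePhoton Ψ) (n : ℕ) (s : Fin n → ℝ) :
    MemLp (fun t => b t Ψ n s) 2 := by
  induction h generalizing n with
  | vacuum => simp [b_vacuum]
  | add _ _ h₁ h₂ =>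
    convert (h₁ n s).add (h₂ n s) using 1
    funext t
    simp [b, mul_add]
  | smul c _ h =>
    simp only [b_smul]
    exact (h n s).const_smul c
  | @creation f Ψ hf _ h =>
    simp only [b_creation, Pi.add_apply, Pi.smul_apply, smul_eq_mul]
    refine (hf.mul_const _).add ?_
    cases n with
    | zero => exact MemLp.zero
    | succ n =>
      exact (memLp_finsetSum _ fun j _ => (h n _).const_mul _).const_mul _

/-- The series defining `braket` is then a finite sum, so summability is automatic. -/
theorem exists_bound {Ψ : FockVector} (h : FinitePhoton Ψ) : ∃ N, ∀ n, N ≤ n → Ψ n = 0 := by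
  induction h with
  | vacuum => exact ⟨1, fun n hn => by funext s; simp [PhotonField.vacuum]; omega⟩
  | add _ _ h₁ h₂ =>
    obtain ⟨N₁, h₁⟩ := h₁
    obtain ⟨N₂, h₂⟩ := h₂
    exact ⟨max N₁ N₂, fun n hn => by
      simp [h₁ n (le_trans (le_max_left _ _) hn), h₂ n (le_trans (le_max_right _ _) hn)]⟩
  | smul c _ h =>
    obtain ⟨N, h⟩ := h
    exact ⟨N, fun n hn => by simp [h n hn]⟩
  | creation hf _ h =>
    obtain ⟨N, h⟩ := h
    refine ⟨N + 1, fun n hn => ?_⟩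
    obtain ⟨n, rfl⟩ : ∃ m, n = m + 1 := ⟨n - 1, by omega⟩
    funext s
    simp [creation_succ_apply, h n (by omega)]

theorem integrable_b {Ψ : FockVector} (h : FinitePhoton Ψ) {f : ℝ → ℂ} (hf : MemLp f 2) (n : ℕ)
    (s : Fin n → ℝ) : Integrable fun t => f t * b t Ψ n s :=
  integrable_mul_two hf (h.memLp_b n s)

end FinitePhoton

/-! ### Commutation and adjointness on finite-photon vectors -/

theorem smearedB_add {f : ℝ → ℂ} (hf : MemLp f 2) {Φ Ψ : FockVector} (hΦ : FinitePhoton Φ)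
    (hΨ : FinitePhoton Ψ) : smearedB f (Φ + Ψ) = smearedB f Φ + smearedB f Ψ := by
  funext n s
  simp only [smearedB, Pi.add_apply]
  rw [← integral_add (hΦ.integrable_b hf n s) (hΨ.integrable_b hf n s)]
  refine integral_congr_ae (.of_forall fun t => ?_)
  simp only [b, Pi.add_apply]
  ring

/-- The smeared canonical commutation relation. -/
theorem smearedB_creation {f g : ℝ → ℂ} (hf : MemLp f 2) (hg : MemLp g 2) {Ψ : FockVector}
    (hΨ : FinitePhoton Ψ) :
    smearedB f (creation g Ψ) = (∫ t, f t * g t) • Ψ + creation g (smearedB f Ψ) := by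
  funext n s
  simp only [smearedB, b_creation, Pi.add_apply, Pi.smul_apply, smul_eq_mul, mul_add,
    ← mul_assoc]
  have h₁ : Integrable fun t => f t * g t * Ψ n s := (integrable_mul_two hf hg).mul_const _
  cases n with
  | zero => simp [creation_zero_apply, integral_mul_const]
  | succ n =>
    simp only [creation_succ_apply]
    have h₂ : ∀ j : Fin (n + 1), Integrable fun t =>
        ((Real.sqrt ((n : ℝ) + 1) : ℂ))⁻¹ * (g (s j) *
          (f t * b t Ψ n fun i => s (j.succAbove i))) := fun j =>
      ((hΨ.integrable_b hf n _).const_mul _).const_mul _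
    have h₃ : ∀ t, f t * (((Real.sqrt ((n : ℝ) + 1) : ℂ))⁻¹ *
        ∑ j, g (s j) * b t Ψ n (fun i => s (j.succAbove i))) =
        ∑ j, ((Real.sqrt ((n : ℝ) + 1) : ℂ))⁻¹ * (g (s j) *
          (f t * b t Ψ n fun i => s (j.succAbove i))) := fun t => by
      rw [Finset.mul_sum, Finset.mul_sum]
      exact Finset.sum_congr rfl fun j _ => by ring
    simp only [h₃]
    rw [integral_add h₁ (integrable_finsetSum _ fun j _ => h₂ j), integral_mul_const,
      integral_finsetSum _ fun j _ => h₂ j, Finset.mul_sum]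
    simp only [integral_const_mul]
    rfl

theorem FinitePhoton.smearedB {f : ℝ → ℂ} (hf : MemLp f 2) {Ψ : FockVector}
    (h : FinitePhoton Ψ) : FinitePhoton (smearedB f Ψ) := by
  induction h with
  | vacuum => exact smearedB_vacuum f ▸ .zero
  | add hΦ hΨ h₁ h₂ => exact smearedB_add hf hΦ hΨ ▸ h₁.add h₂
  | smul c _ h => exact smearedB_smul f c _ ▸ h.smul c
  | creation hg hΨ h => exact smearedB_creation hf hg hΨ ▸ (hΨ.smul _).add (.creation hg h)

theorem FinitePhoton.annihilation {f : ℝ → ℂ} (hf : MemLp f 2) {Ψ : FockVector}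
    (h : FinitePhoton Ψ) : FinitePhoton (annihilation f Ψ) :=
  h.smearedB hf.star

theorem braket_add_right {Φ Ψ₁ Ψ₂ : FockVector} (hΦ : FinitePhoton Φ) (h₁ : FinitePhoton Ψ₁)
    (h₂ : FinitePhoton Ψ₂) : braket Φ (Ψ₁ + Ψ₂) = braket Φ Ψ₁ + braket Φ Ψ₂ := by
  have hs : ∀ Ψ : FockVector, Summable fun n => ∫ s, star (Φ n s) * Ψ n s := fun Ψ => by
    obtain ⟨N, hN⟩ := hΦ.exists_bound
    refine summable_of_ne_finset_zero (s := Finset.range N) fun n hn => ?_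
    simp [hN n (by simpa using hn)]
  rw [braket, braket, braket, ← (hs Ψ₁).tsum_add (hs Ψ₂)]
  refine tsum_congr fun n => ?_
  rw [← integral_add (integrable_star_mul (hΦ.memLp n) (h₁.memLp n))
    (integrable_star_mul (hΦ.memLp n) (h₂.memLp n))]
  simp only [Pi.add_apply, mul_add]

theorem braket_sum_right {ι : Type*} (S : Finset ι) {Φ : FockVector} {Ψ : ι → FockVector}
    (hΦ : FinitePhoton Φ) (hΨ : ∀ i, FinitePhoton (Ψ i)) :
    braket Φ (∑ i ∈ S, Ψ i) = ∑ i ∈ S, braket Φ (Ψ i) := by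
  classical
  induction S using Finset.induction_on with
  | empty => simp [braket_zero_right]
  | insert a S ha ih =>
    rw [Finset.sum_insert ha, Finset.sum_insert ha,
      braket_add_right hΦ (hΨ a) (.sum fun i _ => hΨ i), ih]

theorem braket_sum_smul {ι : Type*} [Fintype ι] {Ψ : ι → FockVector}
    (hΨ : ∀ i, FinitePhoton (Ψ i)) (x y : ι → ℂ) :
    braket (∑ i, x i • Ψ i) (∑ k, y k • Ψ k) =
      ∑ i, ∑ k, star (x i) * y k * braket (Ψ i) (Ψ k) := by
  have hx : FinitePhoton (∑ i, x i • Ψ i) := .sum fun i _ => (hΨ i).smul _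
  rw [braket_sum_right _ hx fun k => (hΨ k).smul _, Finset.sum_comm]
  refine Finset.sum_congr rfl fun k _ => ?_
  rw [braket_smul_right, ← star_braket, braket_sum_right _ (hΨ k) fun i => (hΨ i).smul _,
    star_sum, Finset.mul_sum]
  refine Finset.sum_congr rfl fun i _ => ?_
  rw [braket_smul_right, star_mul', star_braket]
  ring

/-- `B(f)` is adjoint to `B*(f)`. -/
theorem braket_creation_left {f : ℝ → ℂ} (hf : MemLp f 2) {Φ Ψ : FockVector}
    (hΦ : FinitePhoton Φ) (hΨ : FinitePhoton Ψ) :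
    braket (creation f Φ) Ψ = braket Φ (annihilation f Ψ) := by
  -- Creation leaves no zero-photon component, so the series may be shifted by one.
  have h₀ : Function.support (fun n => ∫ s, star (creation f Φ n s) * Ψ n s) ⊆
      Set.range Nat.succ := by
    rintro (_ | n) hn
    · simp [creation_zero_apply] at hn
    · exact ⟨n, rfl⟩
  rw [braket, ← Nat.succ_injective.tsum_eq h₀, braket]
  refine tsum_congr fun n => ?_
  have hterm : ∀ j : Fin (n + 1), Integrable fun s : Fin (n + 1) → ℝ =>
      star (f (s j) * Φ n (fun i => s (j.succAbove i))) * Ψ (n + 1) s := fun j =>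
    integrable_star_mul (memLp_apply_mul_succAbove j hf (hΦ.memLp n)) (hΨ.memLp (n + 1))
  -- By symmetry of `Ψ`, coordinate `j` can be moved to the front, so the integral does not depend
  -- on `j`.
  have hint : ∀ j : Fin (n + 1),
      ∫ s : Fin (n + 1) → ℝ, star (f (s j) * Φ n (fun i => s (j.succAbove i))) * Ψ (n + 1) s =
      ∫ s : Fin n → ℝ, star (Φ n s) *
        ∫ t, star (f t) * Ψ (n + 1) (Fin.cons (α := fun _ => ℝ) t s) := fun j => by
    have hmp := (volume_preserving_piFinSuccAbove (fun _ : Fin (n + 1) => ℝ) j).symm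
    have hi := (hmp.integrable_comp_emb (MeasurableEquiv.measurableEmbedding _)).2 (hterm j)
    rw [← hmp.integral_comp (MeasurableEquiv.measurableEmbedding _)]
    rw [Measure.volume_eq_prod] at hi ⊢
    refine (integral_prod_symm _ hi).trans ?_
    refine integral_congr_ae (.of_forall fun s => ?_)
    simp only [Function.comp_apply]
    rw [← integral_const_mul]
    refine integral_congr_ae (.of_forall fun t => ?_)
    have h₁ : (MeasurableEquiv.piFinSuccAbove (fun _ : Fin (n + 1) => ℝ) j).symm (t, s) =
        Fin.insertNth (α := fun _ => ℝ) j t s := rfl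
    simp only [h₁, hΨ.insertNth, Fin.insertNth_apply_same, Fin.insertNth_apply_succAbove,
      star_mul']
    ring
  -- The `n + 1` equal terms over `√(n + 1)` give exactly the factor in `b`.
  have hsq : ((Real.sqrt ((n : ℝ) + 1) : ℂ))⁻¹ * ((n : ℂ) + 1) =
      (Real.sqrt ((n : ℝ) + 1) : ℂ) := by
    rw [inv_mul_eq_iff_eq_mul₀ (sqrt_succ_ne_zero n), ← Complex.ofReal_mul,
      Real.mul_self_sqrt (by positivity)]
    simp
  calc ∫ s, star (creation f Φ (n + 1) s) * Ψ (n + 1) s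
      = ∫ s, ((Real.sqrt ((n : ℝ) + 1) : ℂ))⁻¹ *
          ∑ j, star (f (s j) * Φ n (fun i => s (j.succAbove i))) * Ψ (n + 1) s := by
        refine integral_congr_ae (.of_forall fun s => ?_)
        simp only [creation_succ_apply, star_mul', star_sum, Finset.sum_mul, Finset.mul_sum,
          star_inv₀, Complex.star_def, Complex.conj_ofReal, mul_assoc]
    _ = ((Real.sqrt ((n : ℝ) + 1) : ℂ))⁻¹ * ((n + 1) * ∫ s : Fin n → ℝ, star (Φ n s) *
          ∫ t, star (f t) * Ψ (n + 1) (Fin.cons (α := fun _ => ℝ) t s)) := by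
        rw [integral_const_mul, integral_finsetSum _ fun j _ => hterm j]
        simp only [hint, Finset.sum_const, Finset.card_univ, Fintype.card_fin, nsmul_eq_mul]
        push_cast
        rfl
    _ = ∫ s : Fin n → ℝ, star (Φ n s) * annihilation f Ψ n s := by
        rw [← mul_assoc, hsq, ← integral_const_mul]
        refine integral_congr_ae (.of_forall fun s => ?_)
        simp only [annihilation, smearedB, b]
        rw [mul_left_comm, ← integral_const_mul]
        congr 1
        refine integral_congr_ae (.of_forall fun t => ?_)
        simp only
        ring

theorem braket_creation_right {f : ℝ → ℂ} (hf : MemLp f 2) {Φ Ψ : FockVector}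
    (hΦ : FinitePhoton Φ) (hΨ : FinitePhoton Ψ) :
    braket Φ (creation f Ψ) = braket (annihilation f Φ) Ψ := by
  rw [← star_braket, braket_creation_left hf hΨ hΦ, star_braket]

/-! ### Products of creation operators -/

section Products

variable {ℓ : ℕ} {ξ : Fin ℓ → ℝ → ℂ}

theorem FinitePhoton.creationProd (hξ : ∀ k, MemLp (ξ k) 2) (L : List (Fin ℓ)) {Ψ : FockVector}
    (h : FinitePhoton Ψ) : FinitePhoton (creationProd ξ L Ψ) := by
  induction L with
  | nil => exact h
  | cons a L ih => exact .creation (hξ a) ih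

theorem FinitePhoton.annihilationProd (hξ : ∀ k, MemLp (ξ k) 2) (L : List (Fin ℓ))
    {Ψ : FockVector} (h : FinitePhoton Ψ) : FinitePhoton (annihilationProd ξ L Ψ) := by
  induction L with
  | nil => exact h
  | cons a L ih => exact ih.annihilation (hξ a)

theorem creationProd_vacuum_eq_zero (ξ : Fin ℓ → ℝ → ℂ) (L : List (Fin ℓ)) {n : ℕ}
    (hn : n ≠ L.length) : creationProd ξ L vacuum n = 0 := by
  induction L generalizing n with
  | nil =>
    funext s
    simp only [List.length_nil, ne_eq] at hn
    simp [creationProd, vacuum, hn]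
  | cons a L ih =>
    cases n with
    | zero => rfl
    | succ n =>
      funext s
      have h := ih (n := n) (by simpa using hn)
      rw [creationProd] at h
      simp [creationProd, creation_succ_apply, h]

theorem creationProd_creation (f : ℝ → ℂ) (L : List (Fin ℓ)) (Ψ : FockVector) :
    creationProd ξ L (creation f Ψ) = creation f (creationProd ξ L Ψ) := by
  induction L with
  | nil => rfl
  | cons a L ih => exact (congrArg (creation (ξ a)) ih).trans (creation_comm _ _ _)

/-- Taking adjoints reverses the order of the factors; commutativity of creation operators restores
it. -/
theorem braket_annihilationProd (hξ : ∀ k, MemLp (ξ k) 2) (L : List (Fin ℓ)) {Φ Ψ : FockVector}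
    (hΦ : FinitePhoton Φ) (hΨ : FinitePhoton Ψ) :
    braket Φ (annihilationProd ξ L Ψ) = braket (creationProd ξ L Φ) Ψ := by
  induction L generalizing Φ with
  | nil => rfl
  | cons a L ih =>
    have h := braket_creation_left (hξ a) hΦ (hΨ.annihilationProd hξ L)
    rw [ih (.creation (hξ a) hΦ), creationProd_creation] at h
    exact h.symm

theorem photonC_eq_braket (hξ : ∀ k, MemLp (ξ k) 2) (i k : Fin ℓ) :
    photonC ξ i k =
      braket (creationProd ξ ((List.finRange ℓ).filter (fun α => α ≠ i)) vacuum)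
        (creationProd ξ ((List.finRange ℓ).filter (fun β => β ≠ k)) vacuum) :=
  braket_annihilationProd hξ _ .vacuum (FinitePhoton.vacuum.creationProd hξ _)

theorem creation_zero (f : ℝ → ℂ) : creation f 0 = 0 := by
  simpa using creation_smul f 0 0

theorem creation_list_sum {ι : Type*} (f : ℝ → ℂ) (L : List ι) (F : ι → FockVector) :
    creation f (L.map F).sum = (L.map fun k => creation f (F k)).sum := by
  induction L with
  | nil => exact creation_zero f
  | cons a L ih => simp [creation_add, ih]

/-- Derivation rule by induction on the list. Distinctness of the entries ensures that the filter
deletes a single factor. -/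
theorem b_creationProd_list (ξ : Fin ℓ → ℝ → ℂ) (t : ℝ) {L : List (Fin ℓ)} (hL : L.Nodup) :
    b t (creationProd ξ L vacuum) =
      (L.map fun k => ξ k t • creationProd ξ (L.filter (fun α => α ≠ k)) vacuum).sum := by
  induction L with
  | nil => exact b_vacuum t
  | cons a L ih =>
    obtain ⟨ha, hL⟩ := List.nodup_cons.1 hL
    have h₁ : L.filter (fun α => α ≠ a) = L :=
      List.filter_eq_self.2 fun x hx => by
        simpa using fun h : x = a => ha (h ▸ hx)
    have h₂ : ∀ k ∈ L, (a :: L).filter (fun α => α ≠ k) = a :: L.filter (fun α => α ≠ k) :=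
      fun k hk => List.filter_cons_of_pos (by simpa using fun h : a = k => ha (h ▸ hk))
    have h₃ : (a :: L).filter (fun α => α ≠ a) = L := by
      rw [List.filter_cons_of_neg (by simp), h₁]
    rw [List.map_cons, List.sum_cons, h₃]
    change b t (creation (ξ a) (creationProd ξ L vacuum)) = _
    rw [b_creation, ih hL, creation_list_sum]
    congr 2
    refine List.map_congr_left fun k hk => ?_
    rw [h₂ k hk, creation_smul]
    rfl

theorem b_creationProd (ξ : Fin ℓ → ℝ → ℂ) (t : ℝ) :
    b t (creationProd ξ (List.finRange ℓ) vacuum) =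
      ∑ k, ξ k t •
        creationProd ξ ((List.finRange ℓ).filter (fun α => α ≠ k)) vacuum := by
  rw [b_creationProd_list ξ t (List.nodup_finRange ℓ), Fin.sum_univ_def]

theorem smearedB_creationProd (hξ : ∀ k, MemLp (ξ k) 2) {f : ℝ → ℂ} (hf : MemLp f 2) :
    smearedB f (creationProd ξ (List.finRange ℓ) vacuum) =
      ∑ k, (∫ t, f t * ξ k t) •
        creationProd ξ ((List.finRange ℓ).filter (fun α => α ≠ k)) vacuum := by
  funext n s
  simp only [smearedB, b_creationProd, Finset.sum_apply, Pi.smul_apply, smul_eq_mul,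
    Finset.mul_sum, ← mul_assoc]
  rw [integral_finsetSum _ fun k _ => (integrable_mul_two hf (hξ k)).mul_const _]
  simp only [integral_mul_const]

/-! ### Positivity of the norm -/

theorem braket_self (Ψ : FockVector) :
    braket Ψ Ψ = ((∑' n, ∫ s, ‖Ψ n s‖ ^ 2 : ℝ) : ℂ) := by
  rw [braket, Complex.ofReal_tsum]
  refine tsum_congr fun n => ?_
  rw [← integral_complex_ofReal]
  refine integral_congr_ae (.of_forall fun s => ?_)
  simp [Complex.conj_mul']

theorem integral_star_mul_self (f : ℝ → ℂ) :
    ∫ t, star (f t) * f t = ((∫ t, ‖f t‖ ^ 2 : ℝ) : ℂ) := by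
  rw [← integral_complex_ofReal]
  refine integral_congr_ae (.of_forall fun s => ?_)
  simp [Complex.conj_mul']

theorem integral_norm_sq_pos {f : ℝ → ℂ} (hf : MemLp f 2) (hf0 : ¬ f =ᵐ[volume] 0) :
    0 < ∫ t, ‖f t‖ ^ 2 := by
  refine lt_of_le_of_ne (integral_nonneg fun t => by positivity) fun h => hf0 ?_
  have h' := (integral_eq_zero_iff_of_nonneg (fun t => by positivity)
    ((memLp_two_iff_integrable_sq_norm hf.1).1 hf)).1 h.symm
  filter_upwards [h'] with t ht
  simpa using ht

theorem braket_vacuum : braket vacuum vacuum = 1 := by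
  rw [braket, tsum_eq_single 0]
  · simp [vacuum, volume_pi, Measure.real]
  · intro n hn
    simp [vacuum, hn]

theorem braket_creation_creation {f g : ℝ → ℂ} (hf : MemLp f 2) (hg : MemLp g 2)
    {Φ Ψ : FockVector} (hΦ : FinitePhoton Φ) (hΨ : FinitePhoton Ψ) :
    braket (creation f Φ) (creation g Ψ) =
      (∫ t, star (f t) * g t) * braket Φ Ψ +
        braket (annihilation g Φ) (annihilation f Ψ) := by
  have hf' : MemLp (fun t => star (f t)) 2 := hf.star
  rw [braket_creation_left hf hΦ (.creation hg hΨ), annihilation, smearedB_creation hf' hg hΨ,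
    braket_add_right hΦ (hΨ.smul _) (.creation hg (hΨ.smearedB hf')), braket_smul_right,
    braket_creation_right hg hΦ (hΨ.smearedB hf')]

/-- The commutation relation gives `‖B*(f)Φ‖² = ‖f‖²‖Φ‖² + ‖B(f)Φ‖²`, so each nonzero pulse keeps
the norm positive. -/
theorem braket_creationProd_pos (hξ : ∀ k, MemLp (ξ k) 2)
    (hξ0 : ∀ k, ¬ ξ k =ᵐ[volume] 0) (L : List (Fin ℓ)) :
    ∃ r : ℝ, 0 < r ∧
      braket (creationProd ξ L vacuum) (creationProd ξ L vacuum) = (r : ℂ) := by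
  induction L with
  | nil => exact ⟨1, one_pos, by simpa [creationProd] using braket_vacuum⟩
  | cons a L ih =>
    obtain ⟨r, hr, h⟩ := ih
    have hP : FinitePhoton (creationProd ξ L vacuum) := FinitePhoton.vacuum.creationProd hξ L
    refine ⟨(∫ t, ‖ξ a t‖ ^ 2) * r +
      ∑' n, ∫ s, ‖annihilation (ξ a) (creationProd ξ L vacuum) n s‖ ^ 2, ?_, ?_⟩
    · exact add_pos_of_pos_of_nonneg (mul_pos (integral_norm_sq_pos (hξ a) (hξ0 a)) hr)
        (tsum_nonneg fun n => integral_nonneg fun s => by positivity)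
    · refine (braket_creation_creation (hξ a) (hξ a) hP hP).trans ?_
      rw [h, integral_star_mul_self, braket_self (annihilation _ _)]
      push_cast
      rfl

/-! ### The normalization coefficient -/

/-- Permutations are sorted by `j = σ 0`. The inverse cycle sends `0` to `j` and `k.succ` to
`j.succAbove k`, matching the sum in `creation`. -/
theorem sum_perm_succ {M : Type*} [AddCommMonoid M] {n : ℕ}
    (F : Equiv.Perm (Fin (n + 1)) → M) :
    ∑ σ, F σ = ∑ j : Fin (n + 1), ∑ τ : Equiv.Perm (Fin n),
      F (j.cycleRange.symm * Equiv.Perm.decomposeFin.symm (0, τ)) := by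
  rw [← Fintype.sum_prod_type']
  symm
  refine Fintype.sum_bijective (fun p : Fin (n + 1) × Equiv.Perm (Fin n) =>
    p.1.cycleRange.symm * Equiv.Perm.decomposeFin.symm (0, p.2)) ?_ _ _ fun _ => rfl
  rw [Fintype.bijective_iff_injective_and_card]
  refine ⟨?_, by simpa using Fintype.card_congr (Equiv.Perm.decomposeFin (n := n)).symm⟩
  rintro ⟨j, τ⟩ ⟨j', τ'⟩ h
  have h0 := congrArg (fun σ : Equiv.Perm (Fin (n + 1)) => σ 0) h
  simp only [Equiv.Perm.mul_apply, Equiv.Perm.decomposeFin_symm_apply_zero,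
    Fin.cycleRange_symm_zero] at h0
  subst h0
  have h1 := Equiv.Perm.decomposeFin.symm.injective (mul_left_cancel h)
  simpa using h1

theorem creationProd_map_succ {n : ℕ} (ξ : Fin (n + 1) → ℝ → ℂ) (L : List (Fin n))
    (Ψ : FockVector) :
    creationProd ξ (L.map Fin.succ) Ψ = creationProd (fun k => ξ k.succ) L Ψ := by
  simp [creationProd, List.foldr_map]

/-- The wave function of `∏_k B*(ξ_k)|0⟩` is the symmetrized product of the pulses. -/
theorem creationProd_finRange_apply {n : ℕ} (ξ : Fin n → ℝ → ℂ) (s : Fin n → ℝ) :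
    creationProd ξ (List.finRange n) vacuum n s =
      ((Real.sqrt (n.factorial : ℝ) : ℂ))⁻¹ *
        ∑ σ : Equiv.Perm (Fin n), ∏ k, ξ k (s (σ k)) := by
  induction n with
  | zero => simp [creationProd, vacuum]
  | succ n ih =>
    rw [List.finRange_succ]
    change creation (ξ 0) (creationProd ξ ((List.finRange n).map Fin.succ) vacuum) (n + 1) s = _
    rw [creationProd_map_succ, creation_succ_apply, sum_perm_succ, Nat.factorial_succ,
      Finset.mul_sum, Finset.mul_sum]
    refine Finset.sum_congr rfl fun j _ => ?_
    rw [ih]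
    simp only [Fin.prod_univ_succ, Equiv.Perm.mul_apply,
      Equiv.Perm.decomposeFin_symm_apply_zero, Equiv.Perm.decomposeFin_symm_apply_succ,
      Fin.cycleRange_symm_zero, Equiv.swap_self, Equiv.refl_apply, Fin.cycleRange_symm_succ]
    rw [← Finset.mul_sum, Nat.cast_mul, Real.sqrt_mul (by positivity)]
    push_cast
    rw [mul_inv]
    ring

/-- Grouped by variable, the integrand is a product of one-variable functions, each integrable as a
product of two square integrable ones. -/
theorem integrable_prod_perm {n : ℕ} {ξ : Fin n → ℝ → ℂ} (hξ : ∀ k, MemLp (ξ k) 2)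
    (σ τ : Equiv.Perm (Fin n)) :
    Integrable fun t : Fin n → ℝ => (∏ k, star (ξ k (t (σ k)))) * ∏ k, ξ k (t (τ k)) := by
  have h : Integrable fun t : Fin n → ℝ =>
      ∏ k, (star (ξ (σ.symm k) (t k)) * ξ (τ.symm k) (t k)) := by
    rw [volume_pi]
    exact Integrable.fintype_prod (f := fun k x => star (ξ (σ.symm k) x) * ξ (τ.symm k) x)
      fun k => integrable_star_mul (hξ _) (hξ _)
  refine h.congr (.of_forall fun t => ?_)
  simp only [Finset.prod_mul_distrib]
  congr 1
  · rw [← Equiv.prod_comp σ]; simp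
  · rw [← Equiv.prod_comp τ]; simp

theorem integral_comp_perm {n : ℕ} (σ : Equiv.Perm (Fin n)) (F : (Fin n → ℝ) → ℂ) :
    ∫ t : Fin n → ℝ, F (fun k => t (σ k)) = ∫ t, F t := by
  exact (volume_measurePreserving_piCongrLeft (fun _ : Fin n => ℝ) σ).symm.integral_comp
    (MeasurableEquiv.measurableEmbedding _) F

theorem normalization_eq_braket {ℓ : ℕ} {ξ : Fin ℓ → ℝ → ℂ} (hξ : ∀ k, MemLp (ξ k) 2) :
    normalization ξ = braket (creationProd ξ (List.finRange ℓ) vacuum)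
      (creationProd ξ (List.finRange ℓ) vacuum) := by
  have hfac : (Real.sqrt (ℓ.factorial : ℝ) : ℂ)⁻¹ * (Real.sqrt (ℓ.factorial : ℝ) : ℂ)⁻¹ *
      (ℓ.factorial : ℂ) = 1 := by
    rw [← mul_inv, ← Complex.ofReal_mul, Real.mul_self_sqrt (by positivity),
      Complex.ofReal_natCast]
    exact inv_mul_cancel₀ (by exact_mod_cast ℓ.factorial_ne_zero)
  -- Relabelling the variables by `σ` reduces the double sum over permutations to `ℓ!` copies of
  -- `N_ℓ`, cancelling the factor `1/ℓ!`.
  have hσ : ∀ σ : Equiv.Perm (Fin ℓ), ∑ τ : Equiv.Perm (Fin ℓ),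
      ∫ t : Fin ℓ → ℝ, (∏ k, star (ξ k (t (σ k)))) * ∏ k, ξ k (t (τ k)) =
        normalization ξ := fun σ => by
    rw [normalization, ← Equiv.sum_comp (Equiv.mulLeft σ)]
    refine Finset.sum_congr rfl fun P _ => ?_
    exact integral_comp_perm σ
      fun t => (∏ k, star (ξ k (t k))) * ∏ k, ξ k (t (P k))
  rw [braket, tsum_eq_single ℓ]
  · symm
    calc ∫ s, star (creationProd ξ (List.finRange ℓ) vacuum ℓ s) *
            creationProd ξ (List.finRange ℓ) vacuum ℓ s
        = ∫ s : Fin ℓ → ℝ, (Real.sqrt (ℓ.factorial : ℝ) : ℂ)⁻¹ *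
            (Real.sqrt (ℓ.factorial : ℝ) : ℂ)⁻¹ *
            ∑ σ : Equiv.Perm (Fin ℓ), ∑ τ : Equiv.Perm (Fin ℓ),
              (∏ k, star (ξ k (s (σ k)))) * ∏ k, ξ k (s (τ k)) := by
          refine integral_congr_ae (.of_forall fun s => ?_)
          simp only [creationProd_finRange_apply, star_mul', star_sum, star_prod, star_inv₀,
            Complex.star_def, Complex.conj_ofReal]
          rw [mul_mul_mul_comm, Finset.sum_mul_sum]
      _ = normalization ξ := by
          rw [integral_const_mul, integral_finsetSum _ fun σ _ =>
            integrable_finsetSum _ fun τ _ => integrable_prod_perm hξ σ τ]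
          simp only [integral_finsetSum _ fun τ _ => integrable_prod_perm hξ _ τ, hσ, Finset.sum_const,
            Finset.card_univ, Fintype.card_perm, Fintype.card_fin, nsmul_eq_mul]
          rw [← mul_assoc, hfac, one_mul]
  · intro n hn
    rw [creationProd_vacuum_eq_zero ξ _ (by simpa using hn)]
    simp

end Products

/-! ### Covariance and intensity -/

section Covariance

variable {ℓ : ℕ} {ξ : Fin ℓ → ℝ → ℂ}

theorem star_photonC (hξ : ∀ k, MemLp (ξ k) 2) (i k : Fin ℓ) :
    star (photonC ξ i k) = photonC ξ k i := by
  rw [photonC_eq_braket hξ, photonC_eq_braket hξ, star_braket]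

theorem braket_creation_smearedB (hξ : ∀ k, MemLp (ξ k) 2) {f g : ℝ → ℂ} (hf : MemLp f 2)
    (hg : MemLp g 2) :
    braket (creationProd ξ (List.finRange ℓ) vacuum)
        (creation g (smearedB f (creationProd ξ (List.finRange ℓ) vacuum))) =
      ∑ i, ∑ k, photonC ξ i k * (∫ t, f t * ξ k t) * ∫ t, g t * star (ξ i t) := by
  have hP : FinitePhoton (creationProd ξ (List.finRange ℓ) vacuum) :=
    FinitePhoton.vacuum.creationProd hξ _
  have hg' : MemLp (fun t => star (g t)) 2 := hg.star
  rw [braket_creation_right hg hP (hP.smearedB hf), annihilation, smearedB_creationProd hξ hg',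
    smearedB_creationProd hξ hf, braket_sum_smul fun k => FinitePhoton.vacuum.creationProd hξ _]
  refine Finset.sum_congr rfl fun i _ => Finset.sum_congr rfl fun k _ => ?_
  have h : star (∫ t, star (g t) * ξ i t) = ∫ t, g t * star (ξ i t) := by
    rw [Complex.star_def, ← integral_conj]
    refine integral_congr_ae (.of_forall fun t => ?_)
    simp
  rw [← photonC_eq_braket hξ, h]
  ring

theorem integral_separable_sum (A : Fin ℓ → Fin ℓ → ℂ) {x y : Fin ℓ → ℝ → ℂ}
    (hx : ∀ k, MemLp (x k) 2) (hy : ∀ k, MemLp (y k) 2) {f g : ℝ → ℂ} (hf : MemLp f 2)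
    (hg : MemLp g 2) :
    ∫ p : ℝ × ℝ, (∑ i, ∑ k, A i k * x k p.1 * y i p.2) * (f p.1 * g p.2) =
      ∑ i, ∑ k, A i k * (∫ t, f t * x k t) * ∫ t, g t * y i t := by
  have h : ∀ i k, Integrable fun p : ℝ × ℝ =>
      A i k * ((f p.1 * x k p.1) * (g p.2 * y i p.2)) := fun i k =>
    ((integrable_mul_two hf (hx k)).mul_prod (integrable_mul_two hg (hy i))).const_mul _
  calc ∫ p : ℝ × ℝ, (∑ i, ∑ k, A i k * x k p.1 * y i p.2) * (f p.1 * g p.2)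
      = ∫ p : ℝ × ℝ, ∑ i, ∑ k, A i k * ((f p.1 * x k p.1) * (g p.2 * y i p.2)) := by
        refine integral_congr_ae (.of_forall fun p => ?_)
        simp only [Finset.sum_mul]
        exact Finset.sum_congr rfl fun i _ => Finset.sum_congr rfl fun k _ => by ring
    _ = _ := by
        rw [integral_finsetSum _ fun i _ => integrable_finsetSum _ fun k _ => h i k]
        refine Finset.sum_congr rfl fun i _ => ?_
        rw [integral_finsetSum _ fun k _ => h i k]
        refine Finset.sum_congr rfl fun k _ => ?_
        rw [integral_const_mul, Measure.volume_eq_prod,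
          integral_prod_mul (fun t => f t * x k t) (fun t => g t * y i t), mul_assoc]

/-- `N_ℓ` is a squared norm, hence real and nonnegative, so passing to its real part loses nothing.
-/
theorem braket_smul_normalization (hξ : ∀ k, MemLp (ξ k) 2) (Φ Ψ : FockVector) :
    braket (((Real.sqrt (normalization ξ).re : ℂ))⁻¹ • Φ)
        (((Real.sqrt (normalization ξ).re : ℂ))⁻¹ • Ψ) =
      (normalization ξ)⁻¹ * braket Φ Ψ := by
  obtain ⟨r, hr, h⟩ : ∃ r : ℝ, 0 ≤ r ∧ normalization ξ = (r : ℂ) :=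
    ⟨_, tsum_nonneg fun n => integral_nonneg fun s => by positivity,
      (normalization_eq_braket hξ).trans (braket_self _)⟩
  rw [braket_smul_right, braket_smul_left, ← mul_assoc, h, Complex.ofReal_re, star_inv₀,
    Complex.star_def, Complex.conj_ofReal, ← mul_inv, ← Complex.ofReal_mul,
    Real.mul_self_sqrt hr]

theorem normalization_ne_zero (hξ : ∀ k, MemLp (ξ k) 2) (hξ0 : ∀ k, ¬ ξ k =ᵐ[volume] 0) :
    normalization ξ ≠ 0 := by
  obtain ⟨r, hr, h⟩ := braket_creationProd_pos hξ hξ0 (List.finRange ℓ)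
  rw [normalization_eq_braket hξ, h]
  exact_mod_cast hr.ne'

theorem braket_smearedB_smearedB (ξ : Fin ℓ → ℝ → ℂ) (f g : ℝ → ℂ) :
    braket (creationProd ξ (List.finRange ℓ) vacuum)
      (smearedB f (smearedB g (creationProd ξ (List.finRange ℓ) vacuum))) = 0 := by
  refine braket_eq_zero fun n => ?_
  by_cases hn : n = ℓ
  · right
    funext s
    have h : creationProd ξ (List.finRange ℓ) vacuum (n + 1 + 1) = 0 :=
      creationProd_vacuum_eq_zero ξ _ (by rw [List.length_finRange]; omega)
    simp [smearedB, b, h]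
  · exact .inl (creationProd_vacuum_eq_zero ξ _ (by simpa using hn))

theorem braket_creation_creation_eq_zero (ξ : Fin ℓ → ℝ → ℂ) (f g : ℝ → ℂ) :
    braket (creationProd ξ (List.finRange ℓ) vacuum)
      (creation f (creation g (creationProd ξ (List.finRange ℓ) vacuum))) = 0 := by
  refine braket_eq_zero fun n => ?_
  by_cases hn : n = ℓ
  · right
    funext s
    match n with
    | 0 => rfl
    | 1 => simp [creation]
    | n + 2 =>
      have h : creationProd ξ (List.finRange ℓ) vacuum n = 0 :=
        creationProd_vacuum_eq_zero ξ _ (by rw [List.length_finRange]; omega)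
      simp [creation_succ_apply, h]
  · exact .inl (creationProd_vacuum_eq_zero ξ _ (by simpa using hn))

theorem covariance_photonState (hξ : ∀ k, MemLp (ξ k) 2) (hξ0 : ∀ k, ¬ ξ k =ᵐ[volume] 0)
    {f g : ℝ → ℂ} (hf : MemLp f 2) (hg : MemLp g 2) :
    covariance (photonState ξ) f g =
      deltaPairing f g • !![(1 : ℂ), 0; 0, 0] +
        kernelPairing
          (fun t r => (normalization ξ)⁻¹ • ∑ i, ∑ k,
            Δ (photonC ξ i k * ξ k t * star (ξ i r)) 0) f g := by
  have hP : FinitePhoton (creationProd ξ (List.finRange ℓ) vacuum) :=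
    FinitePhoton.vacuum.creationProd hξ _
  have hξ' : ∀ k, MemLp (fun t => star (ξ k t)) 2 := fun k => (hξ k).star
  ext j k
  fin_cases j <;> fin_cases k
  · have h := integral_separable_sum (photonC ξ) hξ hξ' hf hg
    have hb : covariance (photonState ξ) f g 0 0 = (∫ t, f t * g t) +
        (normalization ξ)⁻¹ *
          ∑ i, ∑ k, photonC ξ i k * (∫ t, f t * ξ k t) * ∫ t, g t * star (ξ i t) := by
      change braket (photonState ξ) (smearedB f (creation g (photonState ξ))) = _
      -- The commutator term carries `N_ℓ⁻¹ * N_ℓ`, which is one only because `N_ℓ` does not vanish.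
      rw [photonState, creation_smul, smearedB_smul, braket_smul_normalization hξ,
        smearedB_creation hf hg hP,
        braket_add_right hP (hP.smul _) (.creation hg (hP.smearedB hf)), braket_smul_right,
        ← normalization_eq_braket hξ, braket_creation_smearedB hξ hf hg, mul_add,
        mul_left_comm, inv_mul_cancel₀ (normalization_ne_zero hξ hξ0), mul_one]
    refine hb.trans ?_
    rw [← h]
    simp [kernelPairing, deltaPairing, Δ, Matrix.sum_apply, mul_assoc, integral_const_mul]
  · simp [covariance, doubledUp, doubledUpDag, photonState, smearedB_smul,
      braket_smul_normalization hξ, braket_smearedB_smearedB, kernelPairing, Δ,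
      Matrix.sum_apply]
  · simp [covariance, doubledUp, doubledUpDag, photonState, creation_smul,
      braket_smul_normalization hξ, braket_creation_creation_eq_zero, kernelPairing, Δ,
      Matrix.sum_apply]
  -- Conjugating the kernel turns `C^{ik}` into `C^{ki}`; the normal-ordered formula matches after
  -- exchanging `f` with `g` and `i` with `k`.
  · have h := integral_separable_sum (fun i k => photonC ξ k i) hξ' hξ hf hg
    have hb : covariance (photonState ξ) f g 1 1 = (normalization ξ)⁻¹ *
          ∑ i, ∑ k, photonC ξ k i * (∫ t, f t * star (ξ k t)) * ∫ t, g t * ξ i t := by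
      change braket (photonState ξ) (creation f (smearedB g (photonState ξ))) = _
      rw [photonState, smearedB_smul, creation_smul, braket_smul_normalization hξ,
        braket_creation_smearedB hξ hg hf, Finset.sum_comm]
      congr 1
      exact Finset.sum_congr rfl fun i _ => Finset.sum_congr rfl fun k _ => mul_right_comm _ _ _
    refine hb.trans ?_
    rw [← h]
    have hc : ∀ i k, (starRingEnd ℂ) (photonC ξ i k) = photonC ξ k i := star_photonC hξ
    simp [kernelPairing, hc, Δ, Matrix.sum_apply, mul_assoc, integral_const_mul]

theorem intensity_photonState (hξ : ∀ k, MemLp (ξ k) 2) (t : ℝ) :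
    intensity (photonState ξ) t =
      (normalization ξ)⁻¹ * ∑ i, ∑ k, photonC ξ i k * star (ξ i t) * ξ k t := by
  rw [intensity, photonState, b_smul, braket_smul_normalization hξ, b_creationProd,
    braket_sum_smul fun k => FinitePhoton.vacuum.creationProd hξ _]
  congr 1
  refine Finset.sum_congr rfl fun i _ => Finset.sum_congr rfl fun k _ => ?_
  rw [← photonC_eq_braket hξ]
  ring

end Covariance

end PhotonField

theorem mainTheorem10 (ℓ : ℕ) (hℓ : 1 ≤ ℓ) (ξ : Fin ℓ → ℝ → ℂ)
    (hξ : ∀ k, MemLp (ξ k) 2 (volume : Measure ℝ))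
    (hξ0 : ∀ k, ¬ (ξ k =ᵐ[(volume : Measure ℝ)] 0)) :
    (∀ f g : ℝ → ℂ, MemLp f 2 (volume : Measure ℝ) → MemLp g 2 (volume : Measure ℝ) →
      PhotonField.covariance (PhotonField.photonState ξ) f g =
        PhotonField.deltaPairing f g • !![(1 : ℂ), 0; 0, 0] +
          PhotonField.kernelPairing
            (fun t r => (PhotonField.normalization ξ)⁻¹ • ∑ i, ∑ k,
              PhotonField.Δ (PhotonField.photonC ξ i k * ξ k t * star (ξ i r)) 0) f g) ∧
    (∀ t : ℝ, PhotonField.intensity (PhotonField.photonState ξ) t =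
      (PhotonField.normalization ξ)⁻¹ * ∑ i, ∑ k,
        PhotonField.photonC ξ i k * star (ξ i t) * ξ k t) := by
  exact ⟨fun f g hf hg => PhotonField.covariance_photonState hξ hξ0 hf hg,
    PhotonField.intensity_photonState hξ⟩
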